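/- Let $0\le\gamma<w$. For $x\in\mathbb R$ and $N\in\mathbb N$ let $N_x$ be the integer nearest to $xw/\pi$ and put \[ \mathbb I_N(x)=\{n\in\mathbb Z:\ |xw/\pi-n|\le N\},\qquad \Gamma_N(x)=\Big\{z\in\mathbb C:\ \Big|z-N_x\frac{\pi}{w}\Big|<\Big(N+\frac12\Big)\frac{\pi}{w}\Big\}. \] For every $R\in\mathbb R$ there is $N_0\ge 1$, depending only on $w,\gamma,R$, such that the following holds. Let $f$ be an entire function of exponential type at most $\gamma$ (that is, for every $\varepsilon>0$ there is $C$ with $|f(z)|\le Ce^{(\gamma+\varepsilon)|z|}$ for all $z\in\mathbb C$) that is bounded on the real axis, and let \[ L_f=\sup_{t\in\mathbb R}|f(t)|,\qquad L_0(z)=\frac{4wL_f|\sin(wz)|}{\pi(w-\gamma)(1-e^{-\pi})}. \] Then for all integers $N\ge N_0$, all $x\in\mathbb R$ and all $z\in\Gamma_N(x)$ with $|z-x|\le R$, the two-sided series below (with $\frac{\sin u}{u}=1$ at $u=0$) converges, in the sense that its partial sums over $a\le n\le b$ have a limit as $a\to-\infty$ and $b\to+\infty$ independently, and \[ \Big|\sum_{n\in\mathbb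 Z\setminus\mathbb I_N(x)} f\Big(\frac{n\pi}{w}\Big)\,\frac{\sin(wz-n\pi)}{wz-n\pi}\Big|\ \le\ \frac{L_0(z)}{N}, \] with strict inequality whenever $f\not\equiv0$ and $\sin(wz)\ne0$. In particular, for fixed $f$, $x$ and $z\in\mathbb C$ the estimate holds for all sufficiently large $N$ (and then $z\in\Gamma_N(x)$ automatically). -/

import Mathlib

/-- `f` is of exponential type (at most) `γ`: for every `ε > 0` one has
`|f z| ≤ C_ε * exp ((γ + ε) |z|)` on the whole plane.  For an entire `f` and `0 ≤ γ` this says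
`limsup_{r → ∞} log (max_{|z| = r} |f z|) / r ≤ γ`; in particular every entire function whose
exponential type is exactly `γ` satisfies it. -/
def HasExponentialType (f : ℂ → ℂ) (γ : ℝ) : Prop :=
  ∀ ε : ℝ, 0 < ε → ∃ C : ℝ, ∀ z : ℂ, ‖f z‖ ≤ C * Real.exp ((γ + ε) * ‖z‖)

/-- `f` is bounded on the real axis. -/
def BoundedOnReals (f : ℂ → ℂ) : Prop :=
  BddAbove (Set.range fun x : ℝ => ‖f (x : ℂ)‖)

/-- The sup norm on the real axis, `L_f = sup_{x ∈ ℝ} |f x|`. -/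
noncomputable def realSupNorm (f : ℂ → ℂ) : ℝ :=
  ⨆ x : ℝ, ‖f (x : ℂ)‖

/-- The cardinal sine `sin u / u` of a complex variable, continuously extended by `1` at `0`. -/
noncomputable def complexSinc (u : ℂ) : ℂ :=
  if u = 0 then 1 else Complex.sin u / u

/-- The integer `N_x` nearest to `x w / π`. -/
noncomputable def nearestIndex (w x : ℝ) : ℤ :=
  round (x * w / Real.pi)

/-- The index set `I_N(x) = {n ∈ ℤ : |x w / π - n| ≤ N}`. -/
def sampleIndices (w x : ℝ) (N : ℕ) : Set ℤ :=
  {n : ℤ | |x * w / Real.pi - (n : ℝ)| ≤ (N : ℝ)}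

/-- The open disc `Γ_N(x)` with centre `N_x π / w` and radius `(N + 1/2) π / w`. -/
noncomputable def samplingDisc (w x : ℝ) (N : ℕ) : Set ℂ :=
  Metric.ball (((nearestIndex w x : ℝ) * (Real.pi / w) : ℝ) : ℂ)
    (((N : ℝ) + 1 / 2) * (Real.pi / w))

/-- The `n`-th term of the Whittaker-Kotel'nikov-Shannon sampling series of `f` at `z`. -/
noncomputable def wksTerm (f : ℂ → ℂ) (w : ℝ) (z : ℂ) (n : ℤ) : ℂ :=
  f (((n : ℝ) * Real.pi / w : ℝ) : ℂ) * complexSinc ((w : ℂ) * z - (n : ℂ) * (Real.pi : ℂ))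

/-- `L₀(z) = 4 w L_f |sin (w z)| / (π (w - γ) (1 - e^{-π}))`. -/
noncomputable def truncationConst (f : ℂ → ℂ) (w γ : ℝ) (z : ℂ) : ℝ :=
  4 * w * realSupNorm f * ‖Complex.sin ((w : ℂ) * z)‖ /
    (Real.pi * (w - γ) * (1 - Real.exp (-Real.pi)))

/-- The sampling series of `f` at `z` over the indices outside `I_N(x)` converges to `S`, as a
two-sided series: the sums over `n ∉ I_N(x)`, `a ≤ n ≤ b`, tend to `S` when `a → -∞` and `b → +∞`
independently of each other. (The series need not converge absolutely.) -/
def WKSTailHasSum (f : ℂ → ℂ) (w x : ℝ) (N : ℕ) (z S : ℂ) : Prop :=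
  HasSum (Set.indicator (sampleIndices w x N)ᶜ (wksTerm f w z)) S
    (SummationFilter.conditional ℤ)

/-! After rescaling, put g(ζ) = f(ζ/w), σ = γ/w < 1, Z = wz, so that the nodes are nπ and
Phragmén–Lindelöf gives |g(ζ)| ≤ L_f exp(σ|Im ζ|). With G(ζ) = g(ζ)/(Z - ζ), the n-th term of the
series is sin Z times the residue of G/sin at nπ.

On the vertical lines Re ζ = nπ ± π/2 the sine has modulus cosh(Im ζ). When Z lies outside the strip
between them, shifting contours writes the residue through the sech-weighted integrals of G over
these two lines (`sechIntegral_add_sechIntegral`). Neighbouring strips share an edge and the signs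
(-1)^n alternate, so the series telescopes. What remains of the tail is one line integral on each
side of the omitted block. If both lines are at distance at least D from Re Z, each contributes at
most 2 L_f |sin Z| / (π(1 - σ)D), by `norm_sechIntegral_le`. Finally D > (1 - e^{-π})N for large N,
which also makes the estimate strict. -/

open Filter MeasureTheory Set Topology

/-! ### Growth off the real axis -/

/-- A function of exponential type `γ` bounded by `L` on the real axis grows at most like
`L * exp (γ * Re z)` along the rotated right half-plane. -/
lemma norm_I_mul_le_of_hasExponentialType {f : ℂ → ℂ} {γ L : ℝ} (hγ : 0 ≤ γ)
    (hf : Differentiable ℂ f) (hexp : HasExponentialType f γ) (hL : ∀ x : ℝ, ‖f x‖ ≤ L)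
    {z : ℂ} (hz : 0 ≤ z.re) : ‖f (Complex.I * z)‖ ≤ L * Real.exp (γ * z.re) := by
  have key : ∀ ε : ℝ, 0 < ε → ‖f (Complex.I * z)‖ ≤ L * Real.exp ((γ + ε) * z.re) := by
    intro ε hε
    obtain ⟨C, hC⟩ := hexp ε hε
    have hnorm : ∀ ζ : ℂ, ‖f (Complex.I * ζ) * Complex.exp (-((γ + ε : ℝ) : ℂ) * ζ)‖
        = ‖f (Complex.I * ζ)‖ * Real.exp (-((γ + ε) * ζ.re)) := by
      intro ζ
      rw [norm_mul, Complex.norm_exp]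
      congr 2
      rw [← Complex.ofReal_neg, Complex.re_ofReal_mul]
      ring
    -- The factor exp(-(γ+ε)ζ) has modulus 1 on the imaginary axis and cancels the growth on the
    -- positive real axis; ε → 0 comes afterwards.
    have h := PhragmenLindelof.right_half_plane_of_bounded_on_real (C := L)
      (f := fun ζ : ℂ => f (Complex.I * ζ) * Complex.exp (-((γ + ε : ℝ) : ℂ) * ζ)) (z := z)
      (Differentiable.diffContOnCl (by fun_prop)) ?_ ?_ ?_ hz
    · rw [hnorm] at h
      rw [Real.exp_neg, ← div_eq_mul_inv, div_le_iff₀ (Real.exp_pos _)] at h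
      exact h
    · refine ⟨1, by norm_num, γ + ε, Asymptotics.IsBigO.of_bound C ?_⟩
      rw [eventually_inf_principal]
      refine Eventually.of_forall fun ζ hζ => ?_
      have hζ' : 0 < ζ.re := hζ
      rw [hnorm, Real.rpow_one, Real.norm_eq_abs, abs_of_pos (Real.exp_pos _)]
      have h1 := hC (Complex.I * ζ)
      rw [norm_mul, Complex.norm_I, one_mul] at h1
      refine le_trans (mul_le_of_le_one_right (norm_nonneg _) ?_) h1
      rw [Real.exp_le_one_iff]
      have : 0 ≤ (γ + ε) * ζ.re := by positivity
      linarith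
    · refine ⟨C, ?_⟩
      rw [eventually_map]
      filter_upwards [eventually_ge_atTop (0 : ℝ)] with x hx
      have h1 := hC (Complex.I * x)
      rw [norm_mul, Complex.norm_I, one_mul, Complex.norm_real, Real.norm_eq_abs,
        abs_of_nonneg hx] at h1
      rw [hnorm, Complex.ofReal_re, Real.exp_neg, ← div_eq_mul_inv, div_le_iff₀ (Real.exp_pos _)]
      exact h1
    · intro x
      rw [hnorm]
      have h1 := hL (-x)
      have h2 : Complex.I * (x * Complex.I) = ((-x : ℝ) : ℂ) := by
        push_cast
        linear_combination (x : ℂ) * Complex.I_mul_I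
      rw [h2]
      simpa using h1
  have hlim : Tendsto (fun ε : ℝ => L * Real.exp ((γ + ε) * z.re)) (𝓝[>] 0)
      (𝓝 (L * Real.exp (γ * z.re))) := by
    refine Tendsto.mono_left ?_ nhdsWithin_le_nhds
    exact Continuous.tendsto' (by fun_prop) _ _ (by simp)
  exact ge_of_tendsto hlim (by filter_upwards [self_mem_nhdsWithin] with ε hε using key ε hε)

/-- An entire function of exponential type `γ` bounded by `L` on the real axis satisfies
`|f z| ≤ L * exp (γ * |Im z|)`. -/
lemma norm_le_of_hasExponentialType {f : ℂ → ℂ} {γ L : ℝ} (hγ : 0 ≤ γ)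
    (hf : Differentiable ℂ f) (hexp : HasExponentialType f γ) (hL : ∀ x : ℝ, ‖f x‖ ≤ L)
    (z : ℂ) : ‖f z‖ ≤ L * Real.exp (γ * |z.im|) := by
  rcases le_total 0 z.im with h | h
  · have h1 := norm_I_mul_le_of_hasExponentialType hγ hf hexp hL (z := -Complex.I * z) (by simpa)
    have h2 : Complex.I * (-Complex.I * z) = z := by linear_combination -z * Complex.I_mul_I
    rw [h2] at h1
    simpa [abs_of_nonneg h] using h1
  · have h1 := norm_I_mul_le_of_hasExponentialType (f := fun ζ => f (-ζ)) (L := L) hγ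
      (by fun_prop) (fun ε hε => ?_) (fun x => by simpa using hL (-x))
      (z := Complex.I * z) (by simpa)
    · have h2 : -(Complex.I * (Complex.I * z)) = z := by linear_combination -z * Complex.I_mul_I
      simp only [h2] at h1
      simpa [abs_of_nonpos h] using h1
    · obtain ⟨C, hC⟩ := hexp ε hε
      exact ⟨C, fun z => by simpa using hC (-z)⟩

/-! ### Exponential and sech integrals -/

lemma integrable_exp_neg_mul_abs {a : ℝ} (ha : 0 < a) :
    Integrable fun x : ℝ => Real.exp (-a * |x|) := by
  by_contra h
  -- A non-integrable function would have integral 0, but folding onto the half-line gives a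
  -- positive value.
  have h1 := integral_comp_abs (f := fun x => Real.exp (-a * x))
  rw [integral_undef h] at h1
  have h2 : 0 < ∫ x in Ioi (0 : ℝ), Real.exp (-a * x) := by
    rw [integral_exp_mul_Ioi (by linarith)]
    simp [ha]
  linarith

lemma integral_exp_neg_mul_abs {a : ℝ} (ha : 0 < a) :
    ∫ x : ℝ, Real.exp (-a * |x|) = 2 / a := by
  rw [integral_comp_abs (f := fun x => Real.exp (-a * x)), integral_exp_mul_Ioi (by linarith)]
  simp
  ring

lemma exp_mul_abs_div_cosh_le (σ x : ℝ) :
    Real.exp (σ * |x|) / Real.cosh x ≤ 2 * Real.exp (-(1 - σ) * |x|) := by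
  rw [div_le_iff₀ (Real.cosh_pos x), ← Real.cosh_abs, Real.cosh_eq]
  have h : Real.exp (σ * |x|) = Real.exp (-(1 - σ) * |x|) * Real.exp |x| := by
    rw [← Real.exp_add]; congr 1; ring
  rw [h]
  nlinarith [Real.exp_pos (-(1 - σ) * |x|), Real.exp_pos |x|, Real.exp_pos (-|x|),
    mul_pos (Real.exp_pos (-(1 - σ) * |x|)) (Real.exp_pos (-|x|))]

lemma integrable_inv_cosh : Integrable fun x : ℝ => (Real.cosh x)⁻¹ := by
  refine ((integrable_exp_neg_mul_abs one_pos).const_mul 2).mono'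
    (Continuous.aestronglyMeasurable ?_) (Eventually.of_forall fun x => ?_)
  · exact Real.continuous_cosh.inv₀ fun x => (Real.cosh_pos x).ne'
  · rw [norm_inv, Real.norm_eq_abs, abs_of_pos (Real.cosh_pos x)]
    simpa using exp_mul_abs_div_cosh_le 0 x

lemma integral_inv_cosh : ∫ x : ℝ, (Real.cosh x)⁻¹ = Real.pi := by
  have hder : ∀ x : ℝ, HasDerivAt (fun x => Real.arctan (Real.sinh x)) (Real.cosh x)⁻¹ x := by
    intro x
    convert! (Real.hasDerivAt_sinh x).arctan using 1
    have h := Real.cosh_sq x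
    have h' := (Real.cosh_pos x).ne'
    rw [add_comm 1, ← h]
    field_simp
  have htop : Tendsto (fun x => Real.arctan (Real.sinh x)) atTop (𝓝 (Real.pi / 2)) :=
    (tendsto_nhds_of_tendsto_nhdsWithin Real.tendsto_arctan_atTop).comp
      Real.sinhOrderIso.tendsto_atTop
  have hbot : Tendsto (fun x => Real.arctan (Real.sinh x)) atBot (𝓝 (-(Real.pi / 2))) :=
    (tendsto_nhds_of_tendsto_nhdsWithin Real.tendsto_arctan_atBot).comp
      Real.sinhOrderIso.tendsto_atBot
  rw [integral_of_hasDerivAt_of_tendsto hder integrable_inv_cosh hbot htop]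
  ring

/-! ### Weighted integrals over vertical lines -/

/-- The line integral `∫ G (c + iη) / cosh η dη` along the vertical line `Re ζ = c`. -/
noncomputable def sechIntegral (G : ℂ → ℂ) (c : ℝ) : ℂ :=
  ∫ η : ℝ, G (c + η * Complex.I) * ((Real.cosh η)⁻¹ : ℝ)

lemma norm_mul_inv_cosh_le {a : ℂ} {K σ η : ℝ} (hK : 0 ≤ K)
    (ha : ‖a‖ ≤ K * Real.exp (σ * |η|)) :
    ‖a * ((Real.cosh η)⁻¹ : ℝ)‖ ≤ 2 * K * Real.exp (-(1 - σ) * |η|) := by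
  rw [norm_mul, Complex.norm_real, norm_inv, Real.norm_eq_abs, abs_of_pos (Real.cosh_pos η)]
  calc ‖a‖ * (Real.cosh η)⁻¹ ≤ K * Real.exp (σ * |η|) * (Real.cosh η)⁻¹ := by
        gcongr
    _ = K * (Real.exp (σ * |η|) / Real.cosh η) := by ring
    _ ≤ K * (2 * Real.exp (-(1 - σ) * |η|)) := by
        gcongr
        exact exp_mul_abs_div_cosh_le σ η
    _ = _ := by ring

lemma norm_sechIntegral_le {G : ℂ → ℂ} {c K σ : ℝ} (hσ : σ < 1) (hK : 0 ≤ K)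
    (hG : ∀ η : ℝ, ‖G (c + η * Complex.I)‖ ≤ K * Real.exp (σ * |η|)) :
    ‖sechIntegral G c‖ ≤ 4 * K / (1 - σ) := by
  have ha : 0 < 1 - σ := by linarith
  refine (norm_integral_le_of_norm_le ((integrable_exp_neg_mul_abs ha).const_mul (2 * K))
    (Eventually.of_forall fun η => norm_mul_inv_cosh_le hK (hG η))).trans ?_
  rw [integral_const_mul, integral_exp_neg_mul_abs ha]
  apply le_of_eq
  ring

lemma integrable_mul_inv_cosh {G : ℂ → ℂ} {c K σ : ℝ} (hσ : σ < 1) (hK : 0 ≤ K)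
    (hc : Continuous fun η : ℝ => G (c + η * Complex.I))
    (hG : ∀ η : ℝ, ‖G (c + η * Complex.I)‖ ≤ K * Real.exp (σ * |η|)) :
    Integrable fun η : ℝ => G (c + η * Complex.I) * ((Real.cosh η)⁻¹ : ℝ) := by
  have ha : 0 < 1 - σ := by linarith
  refine ((integrable_exp_neg_mul_abs ha).const_mul (2 * K)).mono'
    (Continuous.aestronglyMeasurable ?_)
    (Eventually.of_forall fun η => norm_mul_inv_cosh_le hK (hG η))
  exact hc.mul (Complex.continuous_ofReal.comp
    (Real.continuous_cosh.inv₀ fun x => (Real.cosh_pos x).ne'))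

/-- Indeed |sin(x + iy)|² = sin² x + sinh² y. -/
lemma abs_sinh_im_le_norm_sin (x y : ℝ) :
    |Real.sinh y| ≤ ‖Complex.sin (x + y * Complex.I)‖ := by
  refine abs_le_of_sq_le_sq ?_ (norm_nonneg _)
  have h : Complex.sin (x + y * Complex.I)
      = ((Real.sin x * Real.cosh y : ℝ) : ℂ) + ((Real.cos x * Real.sinh y : ℝ) : ℂ) * Complex.I := by
    rw [Complex.sin_add_mul_I]
    push_cast
    rfl
  rw [h, ← Complex.normSq_eq_norm_sq, Complex.normSq_add_mul_I]
  nlinarith [Real.cosh_sq y, Real.sin_sq_add_cos_sq x, sq_nonneg (Real.sin x),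
    mul_nonneg (sq_nonneg (Real.sin x)) (sq_nonneg (Real.sinh y))]

lemma sin_ne_zero_of_abs_re_le {ζ : ℂ} (hζ : |ζ.re| ≤ Real.pi / 2) (h0 : ζ ≠ 0) :
    Complex.sin ζ ≠ 0 := by
  intro h
  obtain ⟨k, hk⟩ := Complex.sin_eq_zero_iff.1 h
  have hre : ζ.re = k * Real.pi := by
    rw [hk]; simp
  rw [hre, abs_mul, abs_of_pos Real.pi_pos] at hζ
  have hk1 : |(k : ℝ)| < 1 := by nlinarith [Real.pi_pos]
  have hk0 : k = 0 := by
    rw [← Int.cast_abs] at hk1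
    exact Int.abs_lt_one_iff.1 (by exact_mod_cast hk1)
  simp [hk0] at hk
  exact h0 hk

lemma exp_div_four_le_sinh {H : ℝ} (hH : 1 ≤ H) : Real.exp H / 4 ≤ Real.sinh H := by
  rw [Real.sinh_eq]
  have h1 := Real.add_one_le_exp H
  have h2 : Real.exp (-H) ≤ 1 := Real.exp_le_one_iff.2 (by linarith)
  linarith

/-! ### The residue at a node as a sum of two line integrals -/

/-- If `G` is holomorphic on the closed strip `|Re ζ| ≤ π / 2` and of type less than `1` there, then
`(G - G 0) / sin` has equal integrals along both edges of the strip. -/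
lemma sechIntegral_add_sechIntegral_zero {G : ℂ → ℂ} {K σ : ℝ} (hσ0 : 0 ≤ σ) (hσ : σ < 1)
    (hK : 0 ≤ K) (hd : ∀ ζ : ℂ, |ζ.re| ≤ Real.pi / 2 → DifferentiableAt ℂ G ζ)
    (hG : ∀ ζ : ℂ, |ζ.re| ≤ Real.pi / 2 → ‖G ζ‖ ≤ K * Real.exp (σ * |ζ.im|)) :
    sechIntegral G (Real.pi / 2) + sechIntegral G (-(Real.pi / 2)) = 2 * Real.pi * G 0 := by
  have hpi := Real.pi_pos
  -- This is (G - G 0)/sin with the singularity at 0 removed, so Cauchy's theorem suffices. The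
  -- subtracted constant returns G 0 · π from each edge, since sech has integral π.
  set q : ℂ → ℂ := fun ζ => dslope G 0 ζ / dslope Complex.sin 0 ζ with hq
  have hq_ne : ∀ ζ : ℂ, ζ ≠ 0 → q ζ = (G ζ - G 0) / Complex.sin ζ := by
    intro ζ hζ
    simp only [hq]
    rw [dslope_of_ne _ hζ, dslope_of_ne _ hζ, slope_def_field, slope_def_field]
    simp only [sub_zero, Complex.sin_zero]
    rw [div_div_div_cancel_right₀ hζ]
  have hden : ∀ ζ : ℂ, |ζ.re| ≤ Real.pi / 2 → dslope Complex.sin 0 ζ ≠ 0 := by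
    intro ζ hζ
    by_cases h0 : ζ = 0
    · subst h0
      rw [dslope_same]
      simp
    · rw [dslope_of_ne _ h0, slope_def_field]
      simp only [sub_zero, Complex.sin_zero]
      exact div_ne_zero (sin_ne_zero_of_abs_re_le hζ h0) h0
  have hcont : ∀ F : ℂ → ℂ, ∀ ζ : ℂ, DifferentiableAt ℂ F ζ → DifferentiableAt ℂ F 0 →
      ContinuousAt (dslope F 0) ζ := by
    intro F ζ hF hF0
    by_cases h0 : ζ = 0
    · subst h0
      exact continuousAt_dslope_same.2 hF
    · exact (continuousAt_dslope_of_ne h0).2 hF.continuousAt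
  have hstrip : ∀ (a b : ℝ) (ζ : ℂ), ζ ∈ uIcc (-(Real.pi / 2)) (Real.pi / 2) ×ℂ uIcc a b →
      |ζ.re| ≤ Real.pi / 2 := by
    intro a b ζ hζ
    have h := hζ.1
    rw [uIcc_of_le (by linarith)] at h
    exact abs_le.2 h
  have hd0 : DifferentiableAt ℂ G 0 := hd 0 (by simpa using by positivity)
  have hG0 : ‖G 0‖ ≤ K := by simpa using hG 0 (by simpa using by positivity)
  have hrect : ∀ H : ℝ,
      (∫ x : ℝ in -(Real.pi / 2)..Real.pi / 2, q (x + (-H : ℝ) * Complex.I))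
      - (∫ x : ℝ in -(Real.pi / 2)..Real.pi / 2, q (x + H * Complex.I))
      + Complex.I • (∫ y : ℝ in -H..H, q ((Real.pi / 2 : ℝ) + y * Complex.I))
      - Complex.I • (∫ y : ℝ in -H..H, q ((-(Real.pi / 2) : ℝ) + y * Complex.I)) = 0 := by
    intro H
    have h := Complex.integral_boundary_rect_eq_zero_of_differentiable_on_off_countable q
      ⟨-(Real.pi / 2), -H⟩ ⟨Real.pi / 2, H⟩ {0} (countable_singleton 0) ?_ ?_
    · exact h
    · intro ζ hζ
      have hs := hstrip _ _ ζ hζ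
      exact ((hcont G ζ (hd ζ hs) hd0).div
        (hcont Complex.sin ζ Complex.differentiableAt_sin Complex.differentiableAt_sin)
        (hden ζ hs)).continuousWithinAt
    · rintro ζ ⟨hζ, h0⟩
      have h0' : ζ ≠ 0 := h0
      have hs : |ζ.re| ≤ Real.pi / 2 := by
        have h := hζ.1
        simp only at h
        rw [min_eq_left (by linarith), max_eq_right (by linarith)] at h
        exact abs_le.2 ⟨h.1.le, h.2.le⟩
      exact ((differentiableAt_dslope_of_ne h0').2 (hd ζ hs)).div
        ((differentiableAt_dslope_of_ne h0').2 Complex.differentiableAt_sin) (hden ζ hs)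
  -- the horizontal edges contribute nothing in the limit
  have hedge : ∀ s : ℝ, 1 ≤ |s| →
      ‖∫ x : ℝ in -(Real.pi / 2)..Real.pi / 2, q (x + s * Complex.I)‖
        ≤ 8 * K * Real.exp (-(1 - σ) * |s|) * Real.pi := by
    intro s hs
    have h := intervalIntegral.norm_integral_le_of_norm_le_const (a := -(Real.pi / 2))
      (b := Real.pi / 2) (f := fun x : ℝ => q (x + s * Complex.I))
      (C := 8 * K * Real.exp (-(1 - σ) * |s|)) ?_
    · rwa [sub_neg_eq_add, add_halves, abs_of_pos hpi] at h
    · intro x hx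
      rw [uIoc_of_le (by linarith)] at hx
      have him : ((x : ℂ) + s * Complex.I).im = s := by simp
      have hre : ((x : ℂ) + s * Complex.I).re = x := by simp
      have hne : (x : ℂ) + s * Complex.I ≠ 0 := by
        intro h0
        rw [h0] at him
        simp [← him] at hs
        linarith
      have hsin : Real.exp |s| / 4 ≤ ‖Complex.sin (x + s * Complex.I)‖ := by
        refine (exp_div_four_le_sinh hs).trans ?_
        refine le_trans ?_ (abs_sinh_im_le_norm_sin x s)
        rw [Real.abs_sinh]
      have hnum := hG (x + s * Complex.I) (by rw [hre]; exact abs_le.2 ⟨hx.1.le, hx.2⟩)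
      rw [him] at hnum
      have hone : 1 ≤ Real.exp (σ * |s|) := Real.one_le_exp (by positivity)
      rw [hq_ne _ hne, norm_div, div_le_iff₀ (lt_of_lt_of_le (by positivity) hsin)]
      calc ‖G (x + s * Complex.I) - G 0‖ ≤ K * Real.exp (σ * |s|) + K :=
            (norm_sub_le _ _).trans (add_le_add hnum hG0)
        _ ≤ 2 * K * Real.exp (σ * |s|) := by nlinarith
        _ = 8 * K * Real.exp (-(1 - σ) * |s|) * (Real.exp |s| / 4) := by
            have : Real.exp (σ * |s|) = Real.exp (-(1 - σ) * |s|) * Real.exp |s| := by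
              rw [← Real.exp_add]; congr 1; ring
            rw [this]; ring
        _ ≤ _ := by gcongr
  have hexp0 : Tendsto (fun H : ℝ => 8 * K * Real.exp (-(1 - σ) * |H|) * Real.pi) atTop (𝓝 0) := by
    have h1 : Tendsto (fun H : ℝ => Real.exp (-(1 - σ) * |H|)) atTop (𝓝 0) := by
      refine Real.tendsto_exp_atBot.comp ?_
      exact tendsto_abs_atTop_atTop.const_mul_atTop_of_neg (by linarith)
    simpa using (h1.const_mul (8 * K)).mul_const Real.pi
  have hbot : Tendsto (fun H : ℝ => ∫ x : ℝ in -(Real.pi / 2)..Real.pi / 2,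
      q (x + (-H : ℝ) * Complex.I)) atTop (𝓝 0) := by
    refine squeeze_zero_norm' ?_ hexp0
    filter_upwards [eventually_ge_atTop 1] with H hH
    have h := hedge (-H) (by rw [abs_neg]; exact hH.trans (le_abs_self H))
    rwa [abs_neg] at h
  have htop : Tendsto (fun H : ℝ => ∫ x : ℝ in -(Real.pi / 2)..Real.pi / 2,
      q (x + H * Complex.I)) atTop (𝓝 0) := by
    refine squeeze_zero_norm' ?_ hexp0
    filter_upwards [eventually_ge_atTop 1] with H hH
    exact hedge H (hH.trans (le_abs_self H))
  -- the vertical edges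
  have hvert : ∀ c : ℝ, |c| ≤ Real.pi / 2 →
      Integrable (fun y : ℝ => (G (c + y * Complex.I) - G 0) * ((Real.cosh y)⁻¹ : ℝ)) ∧
      ∫ y : ℝ, (G (c + y * Complex.I) - G 0) * ((Real.cosh y)⁻¹ : ℝ)
        = sechIntegral G c - G 0 * Real.pi := by
    intro c hc
    have hre : ∀ y : ℝ, ((c : ℂ) + y * Complex.I).re = c := fun y => by simp
    have him : ∀ y : ℝ, ((c : ℂ) + y * Complex.I).im = y := fun y => by simp
    have h1 : Integrable (fun y : ℝ => G (c + y * Complex.I) * ((Real.cosh y)⁻¹ : ℝ)) := by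
      refine integrable_mul_inv_cosh hσ hK ?_ fun y => ?_
      · rw [continuous_iff_continuousAt]
        intro y
        exact ContinuousAt.comp (g := G) (hd _ (by rwa [hre])).continuousAt (by fun_prop)
      · have h := hG (c + y * Complex.I) (by rwa [hre])
        rwa [him] at h
    have h2 : Integrable (fun y : ℝ => G 0 * ((Real.cosh y)⁻¹ : ℝ)) :=
      integrable_inv_cosh.ofReal.const_mul (G 0)
    have h3 := h1.sub h2
    have h4 : ∫ y : ℝ, G 0 * (((Real.cosh y)⁻¹ : ℝ) : ℂ) = G 0 * Real.pi := by
      rw [integral_const_mul, integral_complex_ofReal, integral_inv_cosh]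
    simp only [sub_mul]
    exact ⟨h3, by rw [integral_sub h1 h2, h4]; rfl⟩
  have hqr : ∀ y : ℝ, q ((Real.pi / 2 : ℝ) + y * Complex.I)
      = (G ((Real.pi / 2 : ℝ) + y * Complex.I) - G 0) * ((Real.cosh y)⁻¹ : ℝ) := by
    intro y
    have hne : ((Real.pi / 2 : ℝ) : ℂ) + y * Complex.I ≠ 0 := by
      intro h
      have := congrArg Complex.re h
      simp at this
    rw [hq_ne _ hne, Complex.sin_add_mul_I, ← Complex.ofReal_sin, ← Complex.ofReal_cos,
      Real.sin_pi_div_two, Real.cos_pi_div_two]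
    simp [div_eq_mul_inv]
  have hql : ∀ y : ℝ, q ((-(Real.pi / 2) : ℝ) + y * Complex.I)
      = -((G ((-(Real.pi / 2) : ℝ) + y * Complex.I) - G 0) * ((Real.cosh y)⁻¹ : ℝ)) := by
    intro y
    have hne : ((-(Real.pi / 2) : ℝ) : ℂ) + y * Complex.I ≠ 0 := by
      intro h
      have := congrArg Complex.re h
      simp at this
    rw [hq_ne _ hne, Complex.sin_add_mul_I, ← Complex.ofReal_sin, ← Complex.ofReal_cos,
      Real.sin_neg, Real.cos_neg, Real.sin_pi_div_two, Real.cos_pi_div_two]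
    simp [div_eq_mul_inv]
  obtain ⟨hir, her⟩ := hvert (Real.pi / 2) (by rw [abs_of_pos (by positivity)])
  obtain ⟨hil, hel⟩ := hvert (-(Real.pi / 2)) (by rw [abs_neg, abs_of_pos (by positivity)])
  have hr := intervalIntegral_tendsto_integral hir tendsto_neg_atTop_atBot tendsto_id
  have hl := intervalIntegral_tendsto_integral hil tendsto_neg_atTop_atBot tendsto_id
  rw [her] at hr
  rw [hel] at hl
  have hlim := ((hbot.sub htop).add (hr.const_smul Complex.I)).add (hl.const_smul Complex.I)
  have hzero := tendsto_nhds_unique hlim ((tendsto_const_nhds (x := (0 : ℂ))).congr fun H => by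
    have h := hrect H
    simp only [hqr, hql, intervalIntegral.integral_neg, smul_neg, sub_neg_eq_add] at h
    exact h.symm)
  simp only [sub_zero, zero_add, smul_eq_mul, ← mul_add] at hzero
  have := (mul_eq_zero.1 hzero).resolve_left Complex.I_ne_zero
  linear_combination this

/-- The same identity for the strip centred at p, by translation. -/
lemma sechIntegral_add_sechIntegral {G : ℂ → ℂ} {K σ p : ℝ} (hσ0 : 0 ≤ σ) (hσ : σ < 1)
    (hK : 0 ≤ K) (hd : ∀ ζ : ℂ, |ζ.re - p| ≤ Real.pi / 2 → DifferentiableAt ℂ G ζ)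
    (hG : ∀ ζ : ℂ, |ζ.re - p| ≤ Real.pi / 2 → ‖G ζ‖ ≤ K * Real.exp (σ * |ζ.im|)) :
    sechIntegral G (p + Real.pi / 2) + sechIntegral G (p - Real.pi / 2)
      = 2 * Real.pi * G p := by
  have h := sechIntegral_add_sechIntegral_zero (G := fun ζ => G (ζ + p)) hσ0 hσ hK
    (fun ζ hζ => by
      have := hd (ζ + p) (by simpa using hζ)
      exact this.comp ζ (by fun_prop))
    (fun ζ hζ => by simpa using hG (ζ + p) (by simpa using hζ))
  have hs : ∀ c : ℝ, sechIntegral (fun ζ => G (ζ + p)) c = sechIntegral G (p + c) := by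
    intro c
    have hadd : ∀ η : ℝ, (c : ℂ) + η * Complex.I + p = ((p + c : ℝ) : ℂ) + η * Complex.I := by
      intro η
      push_cast
      ring
    simp only [sechIntegral, hadd]
  rw [hs, hs, zero_add] at h
  rwa [sub_eq_add_neg]

/-! ### Telescoping two-sided series -/

lemma sum_Icc_int_sub_add_one (v : ℤ → ℂ) {a b : ℤ} (hab : a ≤ b) :
    ∑ n ∈ Finset.Icc a b, (v n - v (n + 1)) = v a - v (b + 1) := by
  induction b, hab using Int.leInduction with
  | base => simp
  | succ n hn ih =>
    have h : Finset.Icc a (n + 1) = insert (n + 1) (Finset.Icc a n) := by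
      ext k
      simp only [Finset.mem_Icc, Finset.mem_insert]
      omega
    rw [h, Finset.sum_insert (by simp), ih]
    ring

/-- A two-sided series which telescopes on both sides of a finite block of zero terms. -/
lemma hasSum_conditional_of_telescoping {t u : ℤ → ℂ} {lo hi : ℤ} (hle : lo ≤ hi + 1)
    (htop : Tendsto u atTop (𝓝 0)) (hbot : Tendsto u atBot (𝓝 0))
    (hin : ∀ n, lo ≤ n → n ≤ hi → t n = 0) (hlt : ∀ n, n < lo → t n = u n - u (n + 1))
    (hgt : ∀ n, hi < n → t n = u n - u (n + 1)) :
    HasSum t (u (hi + 1) - u lo) (SummationFilter.conditional ℤ) := by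
  -- Shifting u by a constant on each side, to vanish at lo and at hi + 1, gives one sequence whose
  -- differences are t everywhere, including the zero block. The block may be empty (lo = hi + 1).
  set v : ℤ → ℂ := fun n =>
    if n ≤ lo then u n - u lo else if n ≤ hi + 1 then 0 else u n - u (hi + 1) with hv
  have htv : ∀ n, t n = v n - v (n + 1) := by
    intro n
    simp only [hv]
    rcases lt_or_ge n lo with h1 | h1
    · rw [hlt n h1, if_pos h1.le, if_pos (by omega)]
      ring
    rcases le_or_gt n hi with h2 | h2
    · rw [hin n h1 h2, if_neg (by omega : ¬ n + 1 ≤ lo), if_pos (by omega : n + 1 ≤ hi + 1)]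
      rcases h1.eq_or_lt with rfl | h3
      · simp
      · rw [if_neg (by omega), if_pos (by omega)]
        ring
    · rw [hgt n h2, if_neg (by omega : ¬ n + 1 ≤ lo), if_neg (by omega : ¬ n + 1 ≤ hi + 1)]
      rcases (show hi + 1 ≤ n by omega).eq_or_lt with rfl | h3
      · rcases hle.eq_or_lt with rfl | h4
        · simp
        · rw [if_neg (by omega), if_pos le_rfl]
          ring
      · rw [if_neg (by omega), if_neg (by omega)]
        ring
  have hvbot : Tendsto v atBot (𝓝 (0 - u lo)) := by
    refine (hbot.sub_const (u lo)).congr' ?_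
    filter_upwards [eventually_le_atBot lo] with n hn
    simp [hv, hn]
  have hvtop : Tendsto v atTop (𝓝 (0 - u (hi + 1))) := by
    refine (htop.sub_const (u (hi + 1))).congr' ?_
    filter_upwards [eventually_gt_atTop (hi + 1)] with n hn
    simp only [hv]
    rw [if_neg (by omega), if_neg (by omega)]
  have hvtop' : Tendsto (fun n => v (n + 1)) atTop (𝓝 (0 - u (hi + 1))) :=
    hvtop.comp (tendsto_atTop_add_const_right _ 1 tendsto_id)
  have hlim : Tendsto (fun p : ℤ × ℤ => v p.1 - v (p.2 + 1)) (atBot ×ˢ atTop)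
      (𝓝 (u (hi + 1) - u lo)) := by
    have h := (hvbot.comp tendsto_fst).sub (hvtop'.comp (tendsto_snd (f := (atBot : Filter ℤ))))
    convert! h using 2
    ring
  unfold HasSum
  rw [SummationFilter.conditional_filter, tendsto_map'_iff]
  refine hlim.congr' ?_
  filter_upwards [(eventually_le_atBot (0 : ℤ)).prod_mk (eventually_ge_atTop (0 : ℤ))] with p hp
  simp only [Function.comp_apply, htv]
  exact (sum_Icc_int_sub_add_one v (hp.1.trans hp.2)).symm

/-! ### The tail as two boundary integrals -/

/-- The tails of the cardinal series with nodes `n * π`, outside the block `[lo, hi]`. -/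
lemma exists_hasSum_complexSinc_tail {g : ℂ → ℂ} {σ L D : ℝ} (hσ0 : 0 ≤ σ) (hσ : σ < 1)
    (hL : 0 ≤ L) (hg : Differentiable ℂ g) (hgrow : ∀ ζ, ‖g ζ‖ ≤ L * Real.exp (σ * |ζ.im|))
    {Z : ℂ} {lo hi : ℤ} (hD : 0 < D) (hlo : ((lo : ℝ) - 1 / 2) * Real.pi + D ≤ Z.re)
    (hhi : Z.re + D ≤ ((hi : ℝ) + 1 / 2) * Real.pi) :
    ∃ S : ℂ, HasSum (indicator {n : ℤ | n < lo ∨ hi < n}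
        fun n => g (n * Real.pi) * complexSinc (Z - n * Real.pi)) S
        (SummationFilter.conditional ℤ) ∧
      ‖S‖ ≤ 4 * L * ‖Complex.sin Z‖ / (Real.pi * (1 - σ) * D) := by
  have hpi := Real.pi_pos
  have ha : 0 < 1 - σ := by linarith
  have hle : lo ≤ hi + 1 := by
    have h : ((lo : ℝ) - 1 / 2) * Real.pi < ((hi : ℝ) + 1 / 2) * Real.pi := by linarith
    have h' := lt_of_mul_lt_mul_right h hpi.le
    have : (lo : ℝ) < ((hi + 1 : ℤ) : ℝ) := by push_cast; linarith
    exact_mod_cast this.le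
  set G : ℂ → ℂ := fun ζ => g ζ / (Z - ζ) with hGdef
  have hGb : ∀ (d : ℝ) (ζ : ℂ), 0 < d → d ≤ |ζ.re - Z.re| →
      ‖G ζ‖ ≤ L / d * Real.exp (σ * |ζ.im|) := by
    intro d ζ hd h
    have h1 : d ≤ ‖Z - ζ‖ := by
      refine h.trans ?_
      rw [abs_sub_comm, ← Complex.sub_re]
      exact Complex.abs_re_le_norm _
    simp only [hGdef]
    rw [norm_div, div_mul_eq_mul_div]
    exact div_le_div₀ (by positivity) (hgrow ζ) hd h1
  have hGd : ∀ ζ : ℂ, 0 < |ζ.re - Z.re| → DifferentiableAt ℂ G ζ := by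
    intro ζ h
    refine (hg ζ).div (by fun_prop) ?_
    intro h0
    rw [sub_eq_zero] at h0
    simp [h0] at h
  -- The line lies midway between the nodes (n-1)π and nπ; the sign turns the sum over the two edges
  -- of a strip into u n - u (n + 1).
  set u : ℤ → ℂ := fun n => Complex.sin Z / (2 * Real.pi) * (-1) ^ n *
    sechIntegral G (n * Real.pi - Real.pi / 2) with hu
  have hunorm : ∀ (n : ℤ) (d : ℝ), 0 < d → d ≤ |n * Real.pi - Real.pi / 2 - Z.re| →
      ‖u n‖ ≤ 2 * L * ‖Complex.sin Z‖ / (Real.pi * (1 - σ) * d) := by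
    intro n d hd h
    have h1 := norm_sechIntegral_le (G := G) (c := n * Real.pi - Real.pi / 2) hσ
      (div_nonneg hL hd.le) fun η => by
        simpa using hGb d (((n * Real.pi - Real.pi / 2 : ℝ) : ℂ) + η * Complex.I) hd (by simpa using h)
    simp only [hu]
    rw [norm_mul, norm_mul, norm_div, norm_zpow, norm_neg, norm_one, one_zpow, mul_one, norm_mul,
      Complex.norm_real, Complex.norm_ofNat, Real.norm_eq_abs, abs_of_pos hpi]
    calc ‖Complex.sin Z‖ / (2 * Real.pi) * ‖sechIntegral G (n * Real.pi - Real.pi / 2)‖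
        ≤ ‖Complex.sin Z‖ / (2 * Real.pi) * (4 * (L / d) / (1 - σ)) := by gcongr
      _ = _ := by field_simp; ring
  have huzero : ∀ l : Filter ℤ,
      Tendsto (fun n : ℤ => |(n : ℝ) * Real.pi - Real.pi / 2 - Z.re|) l atTop →
      Tendsto u l (𝓝 0) := by
    intro l hl
    have h0 : Tendsto (fun n : ℤ => 2 * L * ‖Complex.sin Z‖ /
        (Real.pi * (1 - σ) * |(n : ℝ) * Real.pi - Real.pi / 2 - Z.re|)) l (𝓝 0) :=
      (hl.const_mul_atTop (by positivity)).const_div_atTop _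
    refine squeeze_zero_norm' ?_ h0
    filter_upwards [hl.eventually_gt_atTop 0] with n hn using hunorm n _ hn le_rfl
  -- The margin π/2 + D keeps the whole strip around nπ at distance at least D from the pole Z of G.
  have hstep : ∀ n : ℤ, Real.pi / 2 + D ≤ |n * Real.pi - Z.re| →
      g (n * Real.pi) * complexSinc (Z - n * Real.pi) = u n - u (n + 1) := by
    intro n hn
    have hre : ∀ ζ : ℂ, |ζ.re - n * Real.pi| ≤ Real.pi / 2 → D ≤ |ζ.re - Z.re| := by
      intro ζ hζ
      have h := abs_sub_le (n * Real.pi) ζ.re Z.re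
      rw [abs_sub_comm (n * Real.pi) ζ.re] at h
      linarith
    have h := sechIntegral_add_sechIntegral (G := G) (p := n * Real.pi) hσ0 hσ
      (div_nonneg hL hD.le) (fun ζ hζ => hGd ζ (hD.trans_le (hre ζ hζ)))
      (fun ζ hζ => hGb D ζ hD (hre ζ hζ))
    have hne : Z - n * Real.pi ≠ 0 := by
      intro h0
      have h1 := congrArg Complex.re h0
      simp at h1
      rw [abs_sub_comm, h1, abs_zero] at hn
      linarith
    have hpi' : (Real.pi : ℂ) ≠ 0 := by exact_mod_cast hpi.ne'
    have hs : (((n + 1 : ℤ) : ℝ)) * Real.pi - Real.pi / 2 = n * Real.pi + Real.pi / 2 := by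
      push_cast; ring
    simp only [hu]
    rw [hs, zpow_add_one₀ (by norm_num), complexSinc, if_neg hne,
      Complex.sin_antiperiodic.sub_int_mul_eq, Int.cast_negOnePow]
    have h2 : g (n * Real.pi) * ((-1) ^ n * Complex.sin Z / (Z - n * Real.pi))
        = Complex.sin Z / (2 * Real.pi) * (-1) ^ n * (2 * Real.pi * G ((n * Real.pi : ℝ) : ℂ)) := by
      simp only [hGdef]
      push_cast
      field_simp
    rw [h2, ← h]
    ring
  have hlin : ∀ n : ℤ, n < lo → n * Real.pi + Real.pi / 2 + D ≤ Z.re := by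
    intro n hn
    have h1 : (n : ℝ) + 1 ≤ lo := by exact_mod_cast hn
    nlinarith
  have hlin' : ∀ n : ℤ, hi < n → Z.re + D + Real.pi / 2 ≤ n * Real.pi := by
    intro n hn
    have h1 : (hi : ℝ) + 1 ≤ n := by exact_mod_cast hn
    nlinarith
  have htt : Tendsto (fun n : ℤ => (n : ℝ) * Real.pi - Real.pi / 2 - Z.re) atTop atTop := by
    simp only [sub_eq_add_neg]
    exact tendsto_atTop_add_const_right _ _ (tendsto_atTop_add_const_right _ _
      (tendsto_intCast_atTop_atTop.atTop_mul_const hpi))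
  have htb : Tendsto (fun n : ℤ => (n : ℝ) * Real.pi - Real.pi / 2 - Z.re) atBot atBot := by
    simp only [sub_eq_add_neg]
    exact tendsto_atBot_add_const_right _ _ (tendsto_atBot_add_const_right _ _
      ((tendsto_intCast_atBot_iff.2 tendsto_id).atBot_mul_const hpi))
  refine ⟨u (hi + 1) - u lo, hasSum_conditional_of_telescoping hle
    (huzero _ (tendsto_abs_atTop_atTop.comp htt)) (huzero _ (tendsto_abs_atBot_atTop.comp htb))
    ?_ ?_ ?_, ?_⟩
  · intro n h1 h2
    exact indicator_of_notMem (by simp only [mem_ofPred_eq]; omega) _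
  · intro n h
    rw [indicator_of_mem (by simp [h]), hstep n]
    rw [abs_sub_comm]
    exact le_trans (by linarith [hlin n h]) (le_abs_self _)
  · intro n h
    rw [indicator_of_mem (by simp [h]), hstep n]
    exact le_trans (by linarith [hlin' n h]) (le_abs_self _)
  · have h1 := hunorm (hi + 1) D hD (by
      refine le_trans ?_ (le_abs_self _)
      push_cast
      linarith)
    have h2 := hunorm lo D hD (by
      rw [abs_sub_comm]
      refine le_trans ?_ (le_abs_self _)
      linarith)
    calc ‖u (hi + 1) - u lo‖ ≤ _ := (norm_sub_le _ _).trans (add_le_add h1 h2)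
      _ = _ := by ring

/-! ### Strictness, the index block and the final estimate -/

lemma realSupNorm_pos {f : ℂ → ℂ} (hf : Differentiable ℂ f) (hb : BoundedOnReals f) (h0 : f ≠ 0) :
    0 < realSupNorm f := by
  have hle : ∀ x : ℝ, ‖f x‖ ≤ realSupNorm f := fun x => le_ciSup hb x
  by_contra hneg
  apply h0
  have hz : ∀ x : ℝ, f x = 0 := fun x => norm_le_zero_iff.1 ((hle x).trans (not_lt.1 hneg))
  -- Identity theorem: the real zeros accumulate at 0.
  refine AnalyticOnNhd.eq_of_frequently_eq (z₀ := 0) (fun z _ => hf.analyticAt z)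
    (fun z _ => analyticAt_const) ?_
  have ht : Tendsto (fun x : ℝ => (x : ℂ)) (𝓝[≠] 0) (𝓝[≠] 0) := by
    refine tendsto_nhdsWithin_of_tendsto_nhds_of_eventually_within _
      ((Complex.continuous_ofReal.tendsto' 0 0 (by simp)).mono_left nhdsWithin_le_nhds) ?_
    filter_upwards [self_mem_nhdsWithin] with x hx
    simpa using hx
  exact ht.frequently (Eventually.frequently (Eventually.of_forall fun x => hz x))

lemma compl_sampleIndices (w x : ℝ) (N : ℕ) :
    (sampleIndices w x N)ᶜ
      = {n : ℤ | n < ⌈x * w / Real.pi - N⌉ ∨ ⌊x * w / Real.pi + N⌋ < n} := by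
  ext n
  simp only [sampleIndices, mem_compl_iff, mem_ofPred_eq, Int.lt_ceil, Int.floor_lt, abs_le, not_and_or,
    not_le]
  constructor <;> rintro (h | h)
  · right; linarith
  · left; linarith
  · right; linarith
  · left; linarith

theorem theorem1 (w γ R : ℝ) (hγ : 0 ≤ γ) (hγw : γ < w) :
    ∃ N₀ : ℕ, 1 ≤ N₀ ∧
      ∀ f : ℂ → ℂ, Differentiable ℂ f → HasExponentialType f γ → BoundedOnReals f →
        ∀ (N : ℕ) (x : ℝ) (z : ℂ), N₀ ≤ N → z ∈ samplingDisc w x N → ‖z - (x : ℂ)‖ ≤ R →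
          ∃ S : ℂ, WKSTailHasSum f w x N z S ∧
            ‖S‖ ≤ truncationConst f w γ z / (N : ℝ) ∧
            (f ≠ 0 → Complex.sin ((w : ℂ) * z) ≠ 0 →
              ‖S‖ < truncationConst f w γ z / (N : ℝ)) := by
  have hw : 0 < w := hγ.trans_lt hγw
  have hpi := Real.pi_pos
  -- Chosen so that N ≥ Rw + 2, which is what D > (1 - e^{-π})N needs below.
  refine ⟨⌈|R| * w⌉₊ + 2, by omega, ?_⟩
  intro f hf hexp hb N x z hN _ hzx
  have hNR : R * w + 2 ≤ N := by
    have h1 := Nat.le_ceil (|R| * w)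
    have h2 : ((⌈|R| * w⌉₊ + 2 : ℕ) : ℝ) ≤ N := by exact_mod_cast hN
    push_cast at h2
    have h3 : R * w ≤ |R| * w := by gcongr; exact le_abs_self R
    linarith
  have hN0 : (0 : ℝ) < N := by
    have : 0 < N := by omega
    exact_mod_cast this
  have hle : ∀ x : ℝ, ‖f x‖ ≤ realSupNorm f := fun x => le_ciSup hb x
  have hL : 0 ≤ realSupNorm f := (norm_nonneg _).trans (hle 0)
  have he1 : Real.exp (-Real.pi) < 1 := Real.exp_lt_one_iff.2 (by linarith)
  set e := 1 - Real.exp (-Real.pi) with he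
  have he0 : 0 < e := by linarith
  have hele : e ≤ 1 := by linarith [Real.exp_pos (-Real.pi)]
  -- The two boundary lines are at least (N - 1/2)π from xw, by the rounding of lo and hi, and
  -- Re(wz) is within Rw of xw.
  set D := ((N : ℝ) - 1 / 2) * Real.pi - R * w with hD
  -- Only e ≤ 1 and π > 3 are needed: D ≥ 3(N - 1/2) - Rw ≥ 2N + 1/2 > N.
  have hDN : e * N < D := by
    have hRw : 0 ≤ R * w := mul_nonneg ((norm_nonneg _).trans hzx) hw.le
    have h1 : e * N ≤ N := mul_le_of_le_one_left hN0.le hele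
    have h2 : ((N : ℝ) - 1 / 2) * 3 ≤ ((N : ℝ) - 1 / 2) * Real.pi :=
      mul_le_mul_of_nonneg_left Real.pi_gt_three.le (by linarith)
    linarith
  have heN : 0 < e * N := by positivity
  have hD0 : 0 < D := heN.trans hDN
  have hzre : |w * z.re - x * w| ≤ R * w := by
    have h1 : |z.re - x| ≤ R := by
      have := (Complex.abs_re_le_norm (z - x)).trans hzx
      simpa using this
    rw [show w * z.re - x * w = (z.re - x) * w by ring, abs_mul, abs_of_pos hw]
    gcongr
  obtain ⟨hz1, hz2⟩ := abs_le.1 hzre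
  have hxw : x * w / Real.pi * Real.pi = x * w := div_mul_cancel₀ _ hpi.ne'
  obtain ⟨S, hS, hSn⟩ := exists_hasSum_complexSinc_tail (g := fun ζ => f (ζ / w)) (σ := γ / w)
    (L := realSupNorm f) (Z := w * z) (lo := ⌈x * w / Real.pi - N⌉)
    (hi := ⌊x * w / Real.pi + N⌋) (div_nonneg hγ hw.le) ((div_lt_one hw).2 hγw) hL (by fun_prop)
    (fun ζ => by
      have h := norm_le_of_hasExponentialType hγ hf hexp hle (ζ / w)
      rw [Complex.div_ofReal_im, abs_div, abs_of_pos hw] at h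
      convert! h using 3
      ring) hD0
    (by
      rw [Complex.re_ofReal_mul]
      have h := Int.ceil_lt_add_one (x * w / Real.pi - N)
      nlinarith)
    (by
      rw [Complex.re_ofReal_mul]
      have h := Int.lt_floor_add_one (x * w / Real.pi + N)
      nlinarith)
  have hterm : (fun n : ℤ => f ((n * Real.pi : ℂ) / w) * complexSinc (w * z - n * Real.pi))
      = wksTerm f w z := by
    ext n
    simp only [wksTerm]
    push_cast
    rfl
  rw [hterm, ← compl_sampleIndices] at hS
  set s := ‖Complex.sin (w * z)‖ with hs
  have hwg : 0 < w - γ := by linarith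
  have hconst : truncationConst f w γ z / N
      = 4 * realSupNorm f * s / (Real.pi * (1 - γ / w) * (e * N)) := by
    have : 1 - γ / w = (w - γ) / w := by field_simp
    rw [truncationConst, this, ← he, ← hs]
    field_simp
  have h1g : 0 < 1 - γ / w := by
    have := (div_lt_one hw).2 hγw
    linarith
  refine ⟨S, hS, ?_, fun hf0 hsin => ?_⟩
  · rw [hconst]
    refine hSn.trans ?_
    gcongr
  · rw [hconst]
    refine hSn.trans_lt ?_
    have hLpos := realSupNorm_pos hf hb hf0
    have hspos : 0 < s := norm_pos_iff.2 hsin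
    gcongr
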